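/- For a monoid $M$, let $\mathrm{PSh}(M)$ be the topos of (small) right $M$-sets, i.e. of presheaves on $M$ regarded as a one-object category. A semigroup homomorphism $\phi : M \to N$ between monoids (multiplicative, not necessarily preserving the identity), with $e := \phi(1)$, induces an essential geometric morphism $f : \mathrm{PSh}(M) \to \mathrm{PSh}(N)$ with $$f_! = -\otimes_M eN, \qquad f^* = -\otimes_N Ne \;\cong\; \big(X \mapsto Xe = \{x \in X : xe = x\},\ x\cdot m := x\,\phi(m)\big), \qquad f_* = \mathrm{Hom}_M(Ne,-).$$ If $\phi$ is a monoid homomorphism, then $f^*$ is restriction of the action along $\phi$. A geometric morphism $f : \mathcal F \to \mathcal E$ is called *étale* if there are an object $X$ of $\mathcal E$ and an equivalence $\mathcal F \simeq \mathcal E/X$ such that $f$ is isomorphic to this equivalence followed by the canonical geometric morphism $\mathcal E/X \to \mathcal E$ (whose inverse image functor is $Y \mapsto (X\times Y \to X)$). A subset $S$ of a monoid $N$ is *right-factorable* if $x \in S$, $y \in N$ and $xy \in S$ imply $y \in S$. Write $N^{\ltimes} = \{u \in N : \exists v \in N,\ uv = 1\}$ for the submonoid of right-invertible elements. **Theorem.**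 Let $M$ and $N$ be monoids. (a) Let $\phi : M \to N$ be a monoid homomorphism and $f : \mathrm{PSh}(M) \to \mathrm{PSh}(N)$ the essential geometric morphism induced by $\phi$. Then the following are equivalent: 1. $f$ is étale; 2. $\phi$ is injective, $\phi(M) \subseteq N$ is right-factorable, and for every $n \in N$ there is some $u \in N^{\ltimes}$ with $nu \in \phi(M)$. (b) Let $\phi : M \to N$ be a semigroup homomorphism, let $e = \phi(1)$, and let $f : \mathrm{PSh}(M) \to \mathrm{PSh}(N)$ be the essential geometric morphism induced by $\phi$. Then $f$ is étale if and only if both of the following hold: - the monoid homomorphism $\psi : M \to eNe$, $m \mapsto \phi(m)$, to the monoid $eNe$ with identity $e$, satisfies condition 2 of (a), i.e. $\psi$ is injective, $\psi(M)$ is right-factorable in $eNe$, and for every $n \in eNe$ there is some $u \in (eNe)^{\ltimes}$ with $nu \in \psi(M)$; - the geometric morphism $\mathrm{PSh}(eNe) \to \mathrm{PSh}(N)$ induced by the semigroup inclusion $eNe \subseteq N$ is an equivalence. -/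

import Mathlib

open CategoryTheory CategoryTheory.Limits Opposite

universe u v₁ v₂ u₁ u₂

namespace MonoidTopos

noncomputable section

/-! ### Geometric morphisms -/

/-- A geometric morphism `𝓕 → 𝓔`: an adjunction `f^* ⊣ f_*` with `f^* : 𝓔 ⥤ 𝓕` preserving finite
limits. -/
structure GeometricMorphism (𝓕 : Type u₁) [Category.{v₁} 𝓕] (𝓔 : Type u₂) [Category.{v₂} 𝓔] where
  /-- The inverse image functor `f^*`. -/
  inverseImage : 𝓔 ⥤ 𝓕
  /-- The direct image functor `f_*`. -/
  directImage : 𝓕 ⥤ 𝓔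
  /-- The adjunction `f^* ⊣ f_*`. -/
  adj : inverseImage ⊣ directImage
  /-- The inverse image functor preserves finite limits. -/
  preservesFiniteLimits : PreservesFiniteLimits inverseImage

/-- An essential geometric morphism `𝓕 → 𝓔`: a geometric morphism whose inverse image functor
`f^*` also has a left adjoint `f_!`. -/
structure EssentialGeometricMorphism (𝓕 : Type u₁) [Category.{v₁} 𝓕] (𝓔 : Type u₂)
    [Category.{v₂} 𝓔] extends GeometricMorphism 𝓕 𝓔 where
  /-- The functor `f_!`. -/
  leftImage : 𝓕 ⥤ 𝓔
  /-- The adjunction `f_! ⊣ f^*`. -/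
  leftAdj : leftImage ⊣ inverseImage

section

variable {𝓕 : Type u₁} [Category.{v₁} 𝓕] {𝓔 : Type u₂} [Category.{v₂} 𝓔]

/-- A geometric morphism `f : 𝓕 → 𝓔` is étale if, for some object `X` of `𝓔` and some equivalence
`𝓕 ≌ 𝓔/X`, it is isomorphic to the composite of this equivalence with the canonical geometric
morphism `𝓔/X → 𝓔`. The inverse image functor of the latter is
`Over.star X : Y ↦ (X × Y → X)`, right adjoint to the forgetful functor; geometric morphisms are
isomorphic precisely when their inverse image functors are, so the condition reads
`f^* ≅ Φ⁻¹ ∘ X^*`. -/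
def GeometricMorphism.IsEtale [HasBinaryProducts 𝓔] (f : GeometricMorphism 𝓕 𝓔) : Prop :=
  ∃ (X : 𝓔) (Φ : 𝓕 ≌ Over X), Nonempty (f.inverseImage ≅ Over.star X ⋙ Φ.inverse)

/-- A geometric morphism is an equivalence (of toposes) if its inverse image functor is an
equivalence of categories (its direct image functor is then a quasi-inverse). -/
def GeometricMorphism.IsEquivalence (f : GeometricMorphism 𝓕 𝓔) : Prop :=
  f.inverseImage.IsEquivalence

end

/-! ### The topos of right actions of a monoid -/

/-- The topos of presheaves on a monoid `M`, regarded as a category with one object: the category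
of right `M`-sets. (In `SingleObj M` the composite "first `g`, then `f`" is `f * g`.) -/
abbrev PSh (M : Type u) [Monoid M] : Type (u + 1) := (SingleObj M)ᵒᵖ ⥤ Type u

section

variable {M : Type u} [Monoid M]

/-- The underlying set of a right `M`-set. -/
abbrev carrier (X : PSh M) : Type u := X.obj (op (SingleObj.star M))

/-- The right action `x · m`. -/
def act (X : PSh M) (x : carrier X) (m : M) : carrier X :=
  X.map (Quiver.Hom.op (X := SingleObj.star M) (Y := SingleObj.star M) m) x

lemma act_one (X : PSh M) (x : carrier X) : act X x 1 = x :=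
  X.map_id_apply (op (SingleObj.star M)) x

lemma act_mul (X : PSh M) (x : carrier X) (m n : M) :
    act X x (m * n) = act X (act X x m) n :=
  X.map_comp_apply (Quiver.Hom.op (X := SingleObj.star M) (Y := SingleObj.star M) m)
    (Quiver.Hom.op (X := SingleObj.star M) (Y := SingleObj.star M) n) x

/-- The underlying function of a morphism of right `M`-sets. -/
def toFun {X Y : PSh M} (f : X ⟶ Y) : carrier X → carrier Y :=
  fun x => f.app (op (SingleObj.star M)) x

lemma toFun_act {X Y : PSh M} (f : X ⟶ Y) (x : carrier X) (m : M) :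
    toFun f (act X x m) = act Y (toFun f x) m :=
  NatTrans.naturality_apply f
    (Quiver.Hom.op (X := SingleObj.star M) (Y := SingleObj.star M) m) x

lemma toFun_id (X : PSh M) (x : carrier X) : toFun (𝟙 X) x = x := rfl

lemma toFun_comp {X Y Z : PSh M} (f : X ⟶ Y) (g : Y ⟶ Z) (x : carrier X) :
    toFun (f ≫ g) x = toFun g (toFun f x) := rfl

lemma hom_ext {X Y : PSh M} {f g : X ⟶ Y} (h : ∀ x, toFun f x = toFun g x) : f = g := by
  ext ⟨⟨⟩⟩ x
  exact h x

/-- A set with a right action of `M`, as a presheaf. -/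
def mkPSh (A : Type u) (r : A → M → A) (h1 : ∀ a, r a 1 = a)
    (hmul : ∀ a m n, r a (m * n) = r (r a m) n) : PSh M where
  obj _ := A
  map f := TypeCat.ofHom fun a => r a f.unop
  map_id _ := by
    ext a
    exact h1 a
  map_comp f g := by
    ext a
    exact hmul a f.unop g.unop

/-- An equivariant function, as a morphism of presheaves. -/
def mkHom {X Y : PSh M} (f : carrier X → carrier Y)
    (hf : ∀ x m, f (act X x m) = act Y (f x) m) : X ⟶ Y where
  app _ := TypeCat.ofHom f
  naturality _ _ m := by
    ext x
    exact hf x m.unop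

@[simp] lemma toFun_mkHom {X Y : PSh M} (f : carrier X → carrier Y)
    (hf : ∀ x m, f (act X x m) = act Y (f x) m) (x : carrier X) :
    toFun (mkHom f hf) x = f x := rfl

end

/-! ### The geometric morphism induced by a monoid homomorphism -/

section

variable {M N : Type u} [Monoid M] [Monoid N]

/-- The essential geometric morphism `PSh M → PSh N` induced by a monoid homomorphism
`φ : M → N`: its inverse image functor is restriction of the action along `φ`, and `f_!` and `f_*`
are the left and right Kan extensions. -/
def ofMonoidHom (φ : M →* N) : EssentialGeometricMorphism (PSh M) (PSh N) where
  inverseImage := (Functor.whiskeringLeft _ _ (Type u)).obj (SingleObj.mapHom M N φ).op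
  directImage := (SingleObj.mapHom M N φ).op.ran
  adj := (SingleObj.mapHom M N φ).op.ranAdjunction (Type u)
  leftImage := (SingleObj.mapHom M N φ).op.lan
  leftAdj := (SingleObj.mapHom M N φ).op.lanAdjunction (Type u)
  preservesFiniteLimits :=
    have : PreservesLimitsOfSize.{0, 0} ((Functor.whiskeringLeft _ _ (Type u)).obj
        (SingleObj.mapHom M N φ).op) :=
      ((SingleObj.mapHom M N φ).op.lanAdjunction (Type u)).rightAdjoint_preservesLimits
    inferInstance

/-! ### The geometric morphism induced by a semigroup homomorphism -/

lemma map_one_mul (φ : M →ₙ* N) (m : M) : φ 1 * φ m = φ m := by rw [← map_mul, one_mul]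

lemma map_mul_one (φ : M →ₙ* N) (m : M) : φ m * φ 1 = φ m := by rw [← map_mul, mul_one]

/-- The image `e = φ 1` of a semigroup homomorphism is idempotent. -/
lemma idem (φ : M →ₙ* N) : IsIdempotentElem (φ 1) := map_one_mul φ 1

/-- For a right `N`-set `X` and `e = φ 1`, the right `M`-set `X e = {x | x e = x}`, which is
`X ⊗_N N e`, with `m` acting as `φ m`. -/
def pullObj (φ : M →ₙ* N) (X : PSh N) : PSh M :=
  mkPSh {x : carrier X // act X x (φ 1) = x}
    (fun x m => ⟨act X x.1 (φ m), by rw [← act_mul, map_mul_one]⟩)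
    (fun x => Subtype.ext x.2)
    (fun x m n => Subtype.ext (by
      change act X x.1 (φ (m * n)) = act X (act X x.1 (φ m)) (φ n)
      rw [map_mul, act_mul]))

/-- The functor `X ↦ X e ≅ X ⊗_N N e`. -/
def pull (φ : M →ₙ* N) : PSh N ⥤ PSh M where
  obj := pullObj φ
  map {X Y} f := mkHom (X := pullObj φ X) (Y := pullObj φ Y)
    (fun x => ⟨toFun f x.1, by rw [← toFun_act, x.2]⟩)
    (fun x m => Subtype.ext (toFun_act f x.1 (φ m)))
  map_id _ := rfl
  map_comp _ _ := rfl

/-- The left ideal `N e`, where `e = φ 1`. -/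
abbrev LeftIdeal (φ : M →ₙ* N) : Type u := {a : N // a * φ 1 = a}

/-- For a right `M`-set `Y` and `e = φ 1`, the right `N`-set `Hom_M(N e, Y)` of functions
`h : N e → Y` with `h (a φ(m)) = h(a) m`, with action `(h n)(a) = h (n a)`. -/
def pushObj (φ : M →ₙ* N) (Y : PSh M) : PSh N :=
  mkPSh {h : LeftIdeal φ → carrier Y //
      ∀ (a : LeftIdeal φ) (m : M),
        h ⟨a.1 * φ m, by rw [mul_assoc, map_mul_one]⟩ = act Y (h a) m}
    (fun h n => ⟨fun a => h.1 ⟨n * a.1, by rw [mul_assoc, a.2]⟩, fun a m =>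
      (congrArg h.1 (Subtype.ext (mul_assoc n a.1 (φ m)).symm)).trans
        (h.2 ⟨n * a.1, by rw [mul_assoc, a.2]⟩ m)⟩)
    (fun h => Subtype.ext (funext fun a => congrArg h.1 (Subtype.ext (one_mul a.1))))
    (fun h m n => Subtype.ext (funext fun a => congrArg h.1 (Subtype.ext (mul_assoc m n a.1))))

/-- The functor `Y ↦ Hom_M(N e, Y)`. -/
def push (φ : M →ₙ* N) : PSh M ⥤ PSh N where
  obj := pushObj φ
  map {X Y} f := mkHom (X := pushObj φ X) (Y := pushObj φ Y)
    (fun h => ⟨fun a => toFun f (h.1 a), fun a m =>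
      (congrArg (toFun f) (h.2 a m)).trans (toFun_act f (h.1 a) m)⟩)
    (fun _ _ => rfl)
  map_id _ := rfl
  map_comp _ _ := rfl

/-- The adjunction between `X ↦ X e ≅ X ⊗_N N e` and `Y ↦ Hom_M(N e, Y)`. -/
def pullPushAdj (φ : M →ₙ* N) : pull φ ⊣ push φ :=
  Adjunction.mkOfHomEquiv
    { homEquiv := fun X Y =>
        { toFun := fun g => mkHom (X := X) (Y := pushObj φ Y)
            (fun x => ⟨fun a => toFun g ⟨act X x a.1, by rw [← act_mul, a.2]⟩, fun a m =>
              (congrArg (toFun g) (Subtype.ext (act_mul X x a.1 (φ m)))).trans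
                (toFun_act g ⟨act X x a.1, by rw [← act_mul, a.2]⟩ m)⟩)
            (fun x n => Subtype.ext (funext fun a => congrArg (toFun g)
              (Subtype.ext (act_mul X x n a.1).symm)))
          invFun := fun k => mkHom (X := pullObj φ X) (Y := Y)
            (fun x => (toFun k x.1).1 ⟨φ 1, map_one_mul φ 1⟩)
            (fun x m => by
              rw [← (toFun k x.1).2]
              change (toFun k (act X x.1 (φ m))).1 _ = _
              rw [toFun_act]
              refine congrArg (toFun k x.1).1 (Subtype.ext ?_)
              exact (map_mul_one φ m).trans (map_one_mul φ m).symm)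
          left_inv := fun g => hom_ext fun x => congrArg (toFun g) (Subtype.ext x.2)
          right_inv := fun k => hom_ext fun x => Subtype.ext (funext fun a => by
            change (toFun k (act X x a.1)).1 _ = (toFun k x).1 a
            rw [toFun_act]
            exact congrArg (toFun k x).1 (Subtype.ext a.2)) }
      homEquiv_naturality_left_symm := fun _ _ => rfl
      homEquiv_naturality_right := fun _ _ => rfl }

/-- The right ideal `e N`, where `e = φ 1`. -/
abbrev RightIdeal (φ : M →ₙ* N) : Type u := {a : N // φ 1 * a = a}

/-- The relation `(y m, a) ∼ (y, φ(m) a)` defining `Y ⊗_M e N`. -/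
inductive TensorRel (φ : M →ₙ* N) (Y : PSh M) :
    carrier Y × RightIdeal φ → carrier Y × RightIdeal φ → Prop
  | mk (y : carrier Y) (m : M) (a : RightIdeal φ) :
      TensorRel φ Y (act Y y m, a)
        (y, ⟨φ m * a.1, by rw [← mul_assoc, map_one_mul]⟩)

/-- For a right `M`-set `Y` and `e = φ 1`, the right `N`-set `Y ⊗_M e N`. -/
def extendObj (φ : M →ₙ* N) (Y : PSh M) : PSh N :=
  mkPSh (Quot (TensorRel φ Y))
    (fun t n => Quot.map (fun p => (p.1, ⟨p.2.1 * n, by rw [← mul_assoc, p.2.2]⟩))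
      (by
        rintro _ _ ⟨y, m, a⟩
        have := TensorRel.mk y m (⟨a.1 * n, by rw [← mul_assoc, a.2]⟩ : RightIdeal φ)
        simpa only [mul_assoc] using this) t)
    (by
      rintro ⟨y, a⟩
      exact congrArg (Quot.mk _) (Prod.ext rfl (Subtype.ext (mul_one a.1))))
    (by
      rintro ⟨y, a⟩ m n
      exact congrArg (Quot.mk _) (Prod.ext rfl (Subtype.ext (mul_assoc a.1 m n).symm)))

/-- The functor `Y ↦ Y ⊗_M e N`. -/
def extend (φ : M →ₙ* N) : PSh M ⥤ PSh N where
  obj := extendObj φ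
  map {X Y} f := mkHom (X := extendObj φ X) (Y := extendObj φ Y)
    (Quot.map (fun p => (toFun f p.1, p.2)) (by
      rintro _ _ ⟨y, m, a⟩
      change TensorRel φ Y (toFun f (act X y m), _) _
      rw [toFun_act]
      exact TensorRel.mk _ _ _))
    (by
      rintro ⟨y, a⟩ n
      rfl)
  map_id _ := hom_ext (by rintro ⟨y, a⟩; rfl)
  map_comp _ _ := hom_ext (by rintro ⟨y, a⟩; rfl)

/-- The adjunction between `Y ↦ Y ⊗_M e N` and `X ↦ X e`. -/
def extendPullAdj (φ : M →ₙ* N) : extend φ ⊣ pull φ :=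
  Adjunction.mkOfHomEquiv
    { homEquiv := fun Y X =>
        { toFun := fun g => mkHom (X := Y) (Y := pullObj φ X)
            (fun y => ⟨toFun g (Quot.mk _ (y, ⟨φ 1, map_one_mul φ 1⟩)), 
              (toFun_act g (Quot.mk _ (y, ⟨φ 1, map_one_mul φ 1⟩)) (φ 1)).symm.trans
                (congrArg (toFun g) (congrArg (Quot.mk _)
                  (Prod.ext rfl (Subtype.ext (map_one_mul φ 1)))))⟩)
            (fun y m => Subtype.ext (Eq.trans
              (b := toFun g (Quot.mk _ (y, ⟨φ 1 * φ m, by simp only [map_one_mul]⟩)))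
              (congrArg (toFun g) ((Quot.sound (TensorRel.mk y m _)).trans
                (congrArg (Quot.mk _) (Prod.ext rfl (Subtype.ext
                  ((map_mul_one φ m).trans (map_one_mul φ m).symm))))))
              (toFun_act g (Quot.mk _ (y, ⟨φ 1, map_one_mul φ 1⟩)) (φ m))))
          invFun := fun k => mkHom (X := extendObj φ Y) (Y := X)
            (Quot.lift (fun p => act X (toFun k p.1).1 p.2.1) (by
              rintro _ _ ⟨y, m, a⟩
              change act X (toFun k (act Y y m)).1 a.1 = act X (toFun k y).1 (φ m * a.1)
              rw [toFun_act, act_mul]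
              rfl))
            (by
              rintro ⟨y, a⟩ n
              exact act_mul X _ a.1 n)
          left_inv := fun g => hom_ext (by
            rintro ⟨y, a⟩
            exact (toFun_act g (Quot.mk _ (y, ⟨φ 1, map_one_mul φ 1⟩)) a.1).symm.trans
              (congrArg (toFun g) (congrArg (Quot.mk _)
                (Prod.ext rfl (Subtype.ext a.2)))))
          right_inv := fun k => hom_ext fun y => Subtype.ext (toFun k y).2 }
      homEquiv_naturality_left_symm := fun _ _ => hom_ext (by rintro ⟨y, a⟩; rfl)
      homEquiv_naturality_right := fun _ _ => rfl }

/-- The essential geometric morphism `PSh M → PSh N` induced by a semigroup homomorphism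
`φ : M → N` (not required to preserve `1`). With `e = φ 1`, its inverse image functor is
`X ↦ X e ≅ X ⊗_N N e`, its direct image functor is `Hom_M(N e, -)` and `f_!` is `- ⊗_M e N`. -/
def ofMulHom (φ : M →ₙ* N) : EssentialGeometricMorphism (PSh M) (PSh N) where
  inverseImage := pull φ
  directImage := push φ
  adj := pullPushAdj φ
  leftImage := extend φ
  leftAdj := extendPullAdj φ
  preservesFiniteLimits :=
    have : PreservesLimitsOfSize.{0, 0} (pull φ) :=
      (extendPullAdj φ).rightAdjoint_preservesLimits
    inferInstance

/-- For a monoid homomorphism the two constructions agree up to isomorphism. -/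
def pullIso (φ : M →* N) :
    (ofMulHom (φ : M →ₙ* N)).inverseImage ≅ (ofMonoidHom φ).inverseImage :=
  NatIso.ofComponents (fun X =>
    { hom := mkHom (X := pullObj (φ : M →ₙ* N) X)
        (Y := (SingleObj.mapHom M N φ).op ⋙ X) (fun x => x.1) (fun _ _ => rfl)
      inv := mkHom (X := (SingleObj.mapHom M N φ).op ⋙ X) (Y := pullObj (φ : M →ₙ* N) X)
        (fun x => ⟨x, (congrArg (act X x) (map_one φ)).trans (act_one X x)⟩) (fun _ _ => rfl)
      hom_inv_id := rfl
      inv_hom_id := rfl }) (fun _ => rfl)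

/-! ### The corner monoid `eNe` -/

/-- For an idempotent `e` of a monoid, `eNe` is a monoid with identity `e`. -/
instance cornerMonoid {e : N} (he : IsIdempotentElem e) : Monoid he.Corner where
  mul a b := ⟨a.1 * b.1, (Subsemigroup.corner e).mul_mem a.2 b.2⟩
  mul_assoc a b c := Subtype.ext (mul_assoc a.1 b.1 c.1)
  one := ⟨e, (Subsemigroup.mem_corner_iff he).mpr ⟨he, he⟩⟩
  one_mul a := Subtype.ext ((Subsemigroup.mem_corner_iff he).mp a.2).1
  mul_one a := Subtype.ext ((Subsemigroup.mem_corner_iff he).mp a.2).2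

/-- The inclusion `eNe ⊆ N`, a semigroup homomorphism. -/
def cornerIncl {e : N} (he : IsIdempotentElem e) : he.Corner →ₙ* N where
  toFun a := a.1
  map_mul' _ _ := rfl

/-- The monoid homomorphism part `M → eNe` of a semigroup homomorphism `φ : M → N`,
where `e = φ 1`. -/
def monoidPart (φ : M →ₙ* N) : M →* (idem φ).Corner where
  toFun m := ⟨φ m, (Subsemigroup.mem_corner_iff (idem φ)).mpr ⟨map_one_mul φ m, map_mul_one φ m⟩⟩
  map_one' := rfl
  map_mul' a b := Subtype.ext (map_mul φ a b)

end

/-! ### The algebraic conditions -/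

/-- A subset `S` of a monoid is right-factorable if `x ∈ S` and `x y ∈ S` imply `y ∈ S`. -/
def RightFactorable {N : Type u} [Monoid N] (S : Set N) : Prop :=
  ∀ x y : N, x ∈ S → x * y ∈ S → y ∈ S

/-- The submonoid of right-invertible elements `u`, i.e. those with `u v = 1` for some `v`. -/
def rightInvertible (N : Type u) [Monoid N] : Submonoid N where
  carrier := {u | ∃ v, u * v = 1}
  one_mem' := ⟨1, mul_one 1⟩
  mul_mem' := by
    rintro a b ⟨c, hc⟩ ⟨d, hd⟩
    exact ⟨d * c, by rw [mul_assoc, ← mul_assoc b, hd, one_mul, hc]⟩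

end

end MonoidTopos

/-! By uniqueness of adjoints, `f` is étale exactly when `f_!` is an equivalence `Φ : PSh M ≌ Over
X` followed by the forgetful functor. Write `e = φ 1`.

Necessity. The object under `Φ M` is `f_! M = M ⊗_M eN ≅ eN`, so its structure map to `X` is a point
`x` with `x e = x`. Endomorphisms of `eN` over `X` are the `n ∈ eNe` with `x n = x`. Since `Φ` is
fully faithful, `φ` is a bijection from `M` onto this stabiliser, which gives injectivity, and
right-factorability because `x a = x = x a b` forces `x b = x`. Moreover `Φ M` is a detector, so
maps out of it cover every object over `X`. Covering `1` in the object `N → X`, `1 ↦ x n`, with `n ∈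
eN`, produces `u ∈ Ne` and `v ∈ eN` with `u v = 1` and `x n u = x`, hence `n u ∈ φ(M)`. The case `n
= e` shows `NeN = N`, which makes `PSh(eNe) → PSh(N)` an equivalence.

Sufficiency. For a monoid homomorphism, let `X` be the orbit of the subset `φ(M)` under `A · n = {a
| n a ∈ A}`, and `x` the point `φ(M)`. Right-factorability makes the stabiliser of `x` equal to
`φ(M)`, and every point of `X` is carried to `x` by a right-invertible element. These facts and
injectivity make "fibre over `x`" an equivalence `Over X ≌ PSh M`. It sends `X × Y → X` to `Y`
restricted along `φ`. A semigroup homomorphism factors through `eNe`, and an étale morphism followed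
by an equivalence is étale. -/

namespace MonoidTopos

/-! ### Étale geometric morphisms in terms of the left adjoint of the inverse image -/

section

variable {𝓕 : Type u₁} [Category.{v₁} 𝓕] {𝓔 : Type u₂} [Category.{v₂} 𝓔]

/-- A geometric morphism is étale if and only if the left adjoint of its inverse image functor is
an equivalence to a slice followed by the forgetful functor. -/
lemma isEtale_iff_adjunction [HasBinaryProducts 𝓔] (f : GeometricMorphism 𝓕 𝓔) :
    f.IsEtale ↔
      ∃ (X : 𝓔) (Φ : 𝓕 ≌ Over X), Nonempty (Φ.functor ⋙ Over.forget X ⊣ f.inverseImage) := by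
  refine exists_congr fun X => exists_congr fun Φ => ?_
  have adj := Φ.toAdjunction.comp (Over.forgetAdjStar X)
  exact ⟨fun ⟨i⟩ => ⟨adj.ofNatIsoRight i.symm⟩, fun ⟨a⟩ => ⟨a.rightAdjointUniq adj⟩⟩

lemma isEtale_of_iso [HasBinaryProducts 𝓔] {f g : GeometricMorphism 𝓕 𝓔}
    (i : f.inverseImage ≅ g.inverseImage) (h : f.IsEtale) : g.IsEtale := by
  obtain ⟨X, Φ, ⟨j⟩⟩ := h
  exact ⟨X, Φ, ⟨i.symm ≪≫ j⟩⟩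

/-- An étale geometric morphism followed by an equivalence is étale. -/
lemma isEtale_of_comp_isEquivalence {𝓖 : Type*} [Category 𝓖] [HasBinaryProducts 𝓔]
    [HasBinaryProducts 𝓖] {f : GeometricMorphism 𝓕 𝓔} {g : GeometricMorphism 𝓔 𝓖}
    {h : GeometricMorphism 𝓕 𝓖} (hf : f.IsEtale) (hg : g.IsEquivalence)
    (i : g.inverseImage ⋙ f.inverseImage ≅ h.inverseImage) : h.IsEtale := by
  rw [isEtale_iff_adjunction] at hf ⊢
  obtain ⟨X, Φ, ⟨a⟩⟩ := hf
  have : g.inverseImage.IsEquivalence := hg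
  let E : 𝓔 ≌ 𝓖 := g.inverseImage.asEquivalence.symm
  exact ⟨E.functor.obj X, Φ.trans (Over.postEquiv X E),
    ⟨(a.comp E.toAdjunction).ofNatIsoRight i⟩⟩

end

section

variable {M : Type u} [Monoid M]

/-! ### Sets with a monoid action -/

lemma toFun_over_w {X : PSh M} {E E' : Over X} (f : E ⟶ E') (y : carrier E.left) :
    toFun E'.hom (toFun f.left y) = toFun E.hom y :=
  congrArg (fun k : E.left ⟶ X => toFun k y) (Over.w f)

lemma isIso_of_bijective {X Y : PSh M} (f : X ⟶ Y) (h : Function.Bijective (toFun f)) :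
    IsIso f := by
  have : ∀ c, IsIso (f.app c) := by
    rintro ⟨⟨⟩⟩
    rw [isIso_iff_bijective]
    exact h
  exact NatIso.isIso_of_isIso_app f

lemma bijective_of_isIso {X Y : PSh M} (f : X ⟶ Y) [IsIso f] :
    Function.Bijective (toFun f) := by
  have : IsIso (f.app (op (SingleObj.star M))) := inferInstance
  rwa [isIso_iff_bijective] at this

variable (M) in
/-- The monoid `M` as a right `M`-set. -/
def regular : PSh M := mkPSh M (· * ·) mul_one fun a m n => (mul_assoc a m n).symm

variable (M) in
/-- The generator `1` of the right `M`-set `M`. -/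
def gen : carrier (regular M) := (1 : M)

lemma act_gen (m : M) : act (regular M) (gen M) m = m := one_mul m

lemma toFun_regular {X : PSh M} (f : regular M ⟶ X) (m : M) :
    toFun f m = act X (toFun f (gen M)) m :=
  (congrArg (toFun f) (one_mul m).symm).trans (toFun_act f (gen M) m)

lemma regular_hom_ext {X : PSh M} {f g : regular M ⟶ X}
    (h : toFun f (gen M) = toFun g (gen M)) : f = g :=
  hom_ext fun m => by
    rw [toFun_regular f m, toFun_regular g m, h]

/-- The morphism `M ⟶ X` sending `1` to `x`. -/
def orbitMap (X : PSh M) (x : carrier X) : regular M ⟶ X :=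
  mkHom (X := regular M) (fun m : M => act X x m) fun a m => act_mul X x a m

lemma toFun_orbitMap_gen (X : PSh M) (x : carrier X) :
    toFun (orbitMap X x) (gen M) = x := act_one X x

/-- Maps out of `M` are elements, so unique lifting of such maps is bijectivity. -/
lemma isDetector_regular : IsDetector (regular M) := by
  rw [isDetector_def]
  intro X Y f h
  refine isIso_of_bijective f (Function.bijective_iff_existsUnique _ |>.2 fun y => ?_)
  obtain ⟨k, hk, hu⟩ := h (orbitMap Y y)
  refine ⟨toFun k (gen M), ?_, fun x hx => ?_⟩
  · exact (congrArg (fun l => toFun l (gen M)) hk).trans (toFun_orbitMap_gen Y y)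
  · have := hu (orbitMap X x) (regular_hom_ext (by
      rw [toFun_comp, toFun_orbitMap_gen, toFun_orbitMap_gen]
      exact hx))
    rw [← this, toFun_orbitMap_gen]

end

lemma isDetector_functor_obj {C D : Type*} [Category C] [Category D] (Φ : C ≌ D) {G : C}
    (hG : IsDetector G) : IsDetector (Φ.functor.obj G) := by
  rw [isDetector_def] at hG ⊢
  intro X Y f h
  have : IsIso (Φ.inverse.map f) := by
    refine hG _ fun k => ?_
    obtain ⟨l, hl, hu⟩ := h ((Φ.toAdjunction.homEquiv _ _).symm k)
    refine ⟨Φ.toAdjunction.homEquiv _ _ l, ?_, fun l' hl' => ?_⟩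
    · exact (Φ.toAdjunction.homEquiv_naturality_right l f).symm.trans
        ((Equiv.eq_symm_apply _).1 hl)
    · rw [← Equiv.symm_apply_eq]
      refine hu _ ?_
      dsimp only at hl' ⊢
      rw [← Φ.toAdjunction.homEquiv_naturality_right_symm, hl']
  exact isIso_of_reflects_iso f Φ.inverse

/-- The images of the morphisms from a detector cover every object of a slice. -/
lemma exists_toFun_eq_of_isDetector {N : Type u} [Monoid N] {X : PSh N} {P : Over X}
    (hP : IsDetector P) (Q : Over X) (q : carrier Q.left) :
    ∃ (k : P ⟶ Q) (z : carrier P.left), toFun k.left z = q := by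
  -- `Q'` is the union of the images of all maps `P ⟶ Q`. Every such map factors uniquely through
  -- its inclusion, so a detector sees that inclusion as an isomorphism.
  let Q' : PSh N := mkPSh {q : carrier Q.left // ∃ (k : P ⟶ Q) (z : _), toFun k.left z = q}
    (fun q n => ⟨act Q.left q.1 n, by
      obtain ⟨_, k, z, rfl⟩ := q
      exact ⟨k, act P.left z n, toFun_act _ _ _⟩⟩)
    (fun q => Subtype.ext (act_one _ _)) (fun q m n => Subtype.ext (act_mul _ _ _ _))
  let i : Q' ⟶ Q.left := mkHom (X := Q') (fun q => q.1) fun _ _ => rfl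
  let j : Over.mk (i ≫ Q.hom) ⟶ Q := Over.homMk i rfl
  have hi : Function.Injective (toFun i) := Subtype.val_injective
  have : IsIso j := by
    rw [isDetector_def] at hP
    refine hP j fun h => ?_
    let l : P.left ⟶ Q' := mkHom (Y := Q') (fun z => ⟨toFun h.left z, h, z, rfl⟩)
      fun z n => Subtype.ext (toFun_act h.left z n)
    refine ⟨Over.homMk l (Over.w h), ?_, fun l' hl' => ?_⟩
    · ext1
      rfl
    · ext1
      exact hom_ext fun z => hi (congrArg (fun k : P ⟶ Q => toFun k.left z) hl')
  have : IsIso i := (inferInstance : IsIso ((Over.forget X).map j))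
  obtain ⟨⟨_, k, z, rfl⟩, h⟩ := (bijective_of_isIso i).2 q
  exact ⟨k, z, h⟩

variable {M N : Type u} [Monoid M] [Monoid N]

/-! ### Consequences of étaleness -/

/-- The generator `1 ⊗ e` of `M ⊗_M e N`. -/
def extendGen (φ : M →ₙ* N) : carrier (extendObj φ (regular M)) :=
  Quot.mk _ (gen M, ⟨φ 1, map_one_mul φ 1⟩)

lemma act_extendGen (φ : M →ₙ* N) (n : N) (hn : φ 1 * n = n) :
    act (extendObj φ (regular M)) (extendGen φ) n = Quot.mk _ (gen M, ⟨n, hn⟩) :=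
  congrArg (Quot.mk _) (Prod.ext rfl (Subtype.ext hn))

lemma extendMk_eq (φ : M →ₙ* N) (m : M) (a : RightIdeal φ) :
    (Quot.mk _ (m, a) : carrier (extendObj φ (regular M))) =
      act (extendObj φ (regular M)) (extendGen φ) (φ m * a.1) := by
  rw [act_extendGen φ _ (by rw [← mul_assoc, map_one_mul])]
  have := Quot.sound (TensorRel.mk (φ := φ) (Y := regular M) (gen M) m a)
  rwa [act_gen] at this

lemma act_extendGen_surjective (φ : M →ₙ* N) :
    Function.Surjective (act (extendObj φ (regular M)) (extendGen φ)) := by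
  rintro ⟨m, a⟩
  exact ⟨_, (extendMk_eq φ m a).symm⟩

/-- Multiplication `m ⊗ a ↦ φ(m) a` is well defined on `M ⊗_M eN` and recovers `φ 1 * a` from the
generator acted on by `a`. -/
lemma eq_of_act_extendGen_eq (φ : M →ₙ* N) {a b : N}
    (h : act (extendObj φ (regular M)) (extendGen φ) a =
      act (extendObj φ (regular M)) (extendGen φ) b) : φ 1 * a = φ 1 * b := by
  let q : carrier (extendObj φ (regular M)) → N :=
    Quot.lift (fun p : M × RightIdeal φ => φ p.1 * p.2.1) (by
      rintro _ _ ⟨y, m, a⟩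
      exact (congrArg (· * a.1) (φ.map_mul' y m)).trans (mul_assoc _ _ _))
  have key : ∀ c, q (act (extendObj φ (regular M)) (extendGen φ) c) = φ 1 * c := fun c => by
    change φ 1 * (φ 1 * c) = φ 1 * c
    rw [← mul_assoc, map_one_mul]
  rw [← key, h, key]

lemma extend_map_orbitMap (φ : M →ₙ* N) (m : M) :
    toFun ((extend φ).map (orbitMap (regular M) m)) (extendGen φ) =
      act (extendObj φ (regular M)) (extendGen φ) (φ m) := by
  refine Eq.trans ?_ ((extendMk_eq φ m ⟨φ 1, map_one_mul φ 1⟩).trans ?_)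
  · exact congrArg (fun y => Quot.mk _ (y, _)) (toFun_orbitMap_gen (regular M) m)
  · rw [map_mul_one]

/-- If `Φ` is an equivalence from `PSh M` to a slice lifting `f_!`, then `Φ M` has an underlying
`N`-set isomorphic to `e N`; this records a generator of it. -/
lemma exists_generator (φ : M →ₙ* N) {X : PSh N} (Φ : PSh M ≌ Over X)
    (adj : Φ.functor ⋙ Over.forget X ⊣ pull φ) :
    ∃ g : carrier (Φ.functor.obj (regular M)).left,
      Function.Surjective (act _ g) ∧ (∀ a b, act _ g a = act _ g b → φ 1 * a = φ 1 * b) ∧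
      act _ g (φ 1) = g ∧
      ∀ m : M, toFun (Φ.functor.map (orbitMap (regular M) m)).left g = act _ g (φ m) := by
  let β := (extendPullAdj φ).leftAdjointUniq adj
  let b : extendObj φ (regular M) ⟶ (Φ.functor.obj (regular M)).left := β.hom.app (regular M)
  have : IsIso b := inferInstanceAs (IsIso (β.hom.app (regular M)))
  obtain ⟨hinj, hsurj⟩ := bijective_of_isIso b
  have hb : ∀ n, act _ (toFun b (extendGen φ)) n = toFun b (act _ (extendGen φ) n) :=
    fun n => (toFun_act b _ n).symm
  refine ⟨toFun b (extendGen φ), fun y => ?_, fun a c h => ?_, ?_, fun m => ?_⟩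
  · obtain ⟨z, rfl⟩ := hsurj y
    obtain ⟨n, rfl⟩ := act_extendGen_surjective φ z
    exact ⟨n, hb n⟩
  · rw [hb, hb] at h
    exact eq_of_act_extendGen_eq φ (hinj h)
  · rw [hb, act_extendGen φ _ (map_one_mul φ 1)]
    rfl
  · rw [hb, ← extend_map_orbitMap]
    exact (congrArg (fun k : extendObj φ (regular M) ⟶ (Φ.functor.obj (regular M)).left =>
      toFun k (extendGen φ)) (β.hom.naturality (orbitMap (regular M) m))).symm

/-- The last clause takes `n ∈ eN`, `u ∈ Ne` and `v ∈ eN`, not only elements of the corner: this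
form yields both the condition on `eNe` and, at `n = e`, the identity `u v = 1` behind `NeN = N`. -/
theorem conditions_of_isEtale (φ : M →ₙ* N) (h : (ofMulHom φ).IsEtale) :
    Function.Injective φ ∧
    (∀ a b, a ∈ Set.range φ → a * b ∈ Set.range φ → φ 1 * b = b → b * φ 1 = b →
      b ∈ Set.range φ) ∧
    ∀ n, φ 1 * n = n → ∃ u v, u * v = 1 ∧ u * φ 1 = u ∧ φ 1 * v = v ∧ n * u ∈ Set.range φ := by
  rw [isEtale_iff_adjunction] at h
  obtain ⟨X, Φ, ⟨adj⟩⟩ := h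
  obtain ⟨g, hsurj, heq, hge, hmap⟩ := exists_generator φ Φ adj
  let x : carrier X := toFun (Φ.functor.obj (regular M)).hom g
  -- Universal property of `eN`: a map out of it is a point fixed by `e`.
  have lift : ∀ (E : PSh N) (t : carrier E), act E t (φ 1) = t →
      ∃ k : (Φ.functor.obj (regular M)).left ⟶ E, ∀ a, toFun k (act _ g a) = act E t a := by
    intro E t ht
    choose s hs using hsurj
    have key : ∀ {a b}, act _ g a = act _ g b → act E t a = act E t b := fun {a b} h => by
      rw [← ht, ← act_mul, ← act_mul, heq a b h]
    refine ⟨mkHom (fun y => act E t (s y)) fun y n => ?_, fun a => key (hs _)⟩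
    rw [← act_mul]
    refine key ?_
    rw [hs, act_mul, hs]
  have hx : ∀ m, act X x (φ m) = x := fun m => by
    rw [← toFun_act, ← hmap, toFun_over_w]
  -- If `x n = x`, then `g ↦ g n` is an endomorphism over `X`. Fullness of `Φ` makes it the image of
  -- left multiplication by some `m`, and comparing values at `g` gives `φ m = n`.
  have hstab : ∀ n, φ 1 * n = n → n * φ 1 = n → act X x n = x → n ∈ Set.range φ := by
    intro n h1 h2 hn
    obtain ⟨k, hk⟩ := lift _ (act _ g n) (by rw [← act_mul, h2])
    have hkg : toFun k g = act _ g n := by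
      have := hk (φ 1)
      rwa [hge, ← act_mul, h2] at this
    let k' : Φ.functor.obj (regular M) ⟶ Φ.functor.obj (regular M) :=
        Over.homMk k (hom_ext fun y => by
      obtain ⟨a, rfl⟩ := hsurj y
      change toFun (Φ.functor.obj (regular M)).hom (toFun k _) = _
      rw [hk, toFun_act, toFun_act, toFun_act]
      exact congrArg (fun z => act X z a) hn)
    let μ := Φ.functor.preimage k'
    refine ⟨toFun μ (gen M), ?_⟩
    have h3 : μ = orbitMap (regular M) (toFun μ (gen M)) :=
      regular_hom_ext (toFun_orbitMap_gen _ _).symm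
    have h4 := hmap (toFun μ (gen M))
    rw [← h3, Φ.functor.map_preimage] at h4
    have h5 := heq _ _ (h4.symm.trans hkg)
    exact (map_one_mul φ _).symm.trans (h5.trans h1)
  refine ⟨fun m m' h => ?_, fun a b ha hab h1 h2 => ?_, fun n hn => ?_⟩
  · have h1 : orbitMap (regular M) m = orbitMap (regular M) m' := by
      refine Φ.functor.map_injective ?_
      ext1
      refine hom_ext fun y => ?_
      obtain ⟨a, rfl⟩ := hsurj y
      rw [toFun_act, toFun_act, hmap, hmap, h]
    have h2 := congrArg (fun k => toFun k (gen M)) h1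
    exact (toFun_orbitMap_gen (regular M) m).symm.trans
      (h2.trans (toFun_orbitMap_gen (regular M) m'))
  · refine hstab b h1 h2 ?_
    obtain ⟨m, rfl⟩ := ha
    obtain ⟨m', h'⟩ := hab
    rw [← hx m, ← act_mul, ← h', hx, hx]
  · obtain ⟨k, z, hz⟩ := exists_toFun_eq_of_isDetector
      (isDetector_functor_obj Φ isDetector_regular)
      (Over.mk (orbitMap X (act X x n))) (gen N)
    obtain ⟨a, rfl⟩ := hsurj z
    let u : N := toFun k.left g
    have hua : u * a = 1 := (toFun_act k.left g a).symm.trans hz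
    have hue : u * φ 1 = u := (toFun_act k.left g (φ 1)).symm.trans (congrArg _ hge)
    have hxu : act X x (n * u) = x := (act_mul X x n u).trans (toFun_over_w k g)
    -- Since `u e = u`, replacing `a` by `e a` keeps the product equal to `1` and places the right
    -- inverse in `eN`.
    refine ⟨u, φ 1 * a, by rw [← mul_assoc, hue, hua], hue,
      by rw [← mul_assoc, map_one_mul], hstab _ ?_ ?_ hxu⟩
    · rw [← mul_assoc, hn]
    · rw [mul_assoc, hue]

/-! ### The corner of an idempotent `e` with `N e N = N` -/

/-- An element `n = e n = n e`, as an element of the corner monoid `e N e`. -/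
def cornerMk {e : N} (he : IsIdempotentElem e) (n : N) (h1 : e * n = n) (h2 : n * e = n) :
    he.Corner :=
  ⟨n, (Subsemigroup.mem_corner_iff he).2 ⟨h1, h2⟩⟩

lemma cornerIncl_one {e : N} (he : IsIdempotentElem e) : cornerIncl he 1 = e := rfl

/-- The morphism of `N`-sets with given values on `X e`, if `1 = u v` with `u ∈ N e` and
`v ∈ e N`. -/
lemma exists_extension {e : N} (he : IsIdempotentElem e) {u v : N} (huv : u * v = 1)
    (hu : u * e = u) (hv : e * v = v) {X Y : PSh N}
    (h : pullObj (cornerIncl he) X ⟶ pullObj (cornerIncl he) Y) :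
    ∃ f : X ⟶ Y, (pull (cornerIncl he)).map f = h := by
  have hmem : ∀ x : carrier X, act X (act X x u) (cornerIncl he 1) = act X x u := fun x => by
    rw [← act_mul, cornerIncl_one, hu]
  have key : ∀ (x : carrier (pullObj (cornerIncl he) X)) (c : N) (h1 : e * c = c)
      (h2 : c * e = c) (y : carrier (pullObj (cornerIncl he) X)), y.1 = act X x.1 c →
      (toFun h y).1 = act Y (toFun h x).1 c := by
    intro x c h1 h2 y hy
    have : y = act _ x (cornerMk he c h1 h2) := Subtype.ext hy
    rw [this]
    exact congrArg Subtype.val (toFun_act h x (cornerMk he c h1 h2))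
  -- An extension `f` must satisfy `f(x) = f(x u) v`, where `x u ∈ X e`, so it is forced to be `x ↦
  -- h(x u) v`.
  let F : carrier X → carrier Y := fun x => (toFun h ⟨act X x u, hmem x⟩).1
  have hF : ∀ (x : carrier (pullObj (cornerIncl he) X)) (z : carrier X) (c : N), e * c = c →
      c * e = c → act X z u = act X x.1 c → F z = act Y (toFun h x).1 c :=
    fun x z c h1 h2 hz => key x c h1 h2 ⟨act X z u, hmem z⟩ hz
  refine ⟨mkHom (fun x => act Y (F x) v) fun x n => ?_, hom_ext fun x =>
    Subtype.ext ?_⟩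
  -- The element `v n u` lies in `eNe` and carries `x u` to `x n u`, because `u v = 1`.
  · rw [hF ⟨act X x u, hmem x⟩ (act X x n) (v * (n * u)) (by rw [← mul_assoc, hv])
      (by rw [mul_assoc, mul_assoc, hu])]
    · change act Y (act Y (F x) _) v = act Y (act Y (F x) v) n
      rw [← act_mul, ← act_mul, mul_assoc, mul_assoc, huv, mul_one]
    · change act X (act X x n) u = act X (act X x u) _
      rw [← act_mul, ← act_mul, ← mul_assoc u, huv, one_mul]
  · have hx : act X x.1 e = x.1 := x.2
    change act Y (F x.1) v = (toFun h x).1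
    rw [hF x x.1 (e * u) (by rw [← mul_assoc, he.eq]) (by rw [mul_assoc, hu])]
    · rw [← act_mul, mul_assoc, huv, mul_one]
      exact (toFun h x).2
    · rw [act_mul]
      exact congrArg (fun z => act X z u) hx.symm

/-- Full faithfulness comes from `x = (x u) v`, which determines a map by its values on `X e`. For
essential surjectivity the counit is invertible: an `h : Ne → Y` fixed by `e` satisfies `h(a) = h(e
a) = h(e) · (e a)`, so it is determined by `h(e)`, which is arbitrary. -/
theorem isEquivalence_cornerIncl {e : N} (he : IsIdempotentElem e) {u v : N} (huv : u * v = 1)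
    (hu : u * e = u) (hv : e * v = v) : (ofMulHom (cornerIncl he)).IsEquivalence := by
  have hfaithful : (pull (cornerIncl he)).Faithful := ⟨fun {X Y f g} h => hom_ext fun x => by
    have h1 := congrArg (fun k : pullObj (cornerIncl he) X ⟶ pullObj (cornerIncl he) Y =>
      (toFun k ⟨act X x u, by rw [← act_mul, cornerIncl_one, hu]⟩).1) h
    have h2 : toFun f (act X x u) = toFun g (act X x u) := h1
    rw [← act_one X x, ← huv, act_mul, toFun_act, h2, ← toFun_act]⟩
  have hfull : (pull (cornerIncl he)).Full := ⟨fun h => exists_extension he huv hu hv h⟩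
  have hess : (pull (cornerIncl he)).EssSurj := ⟨fun Y => by
    let φ := cornerIncl he
    have hp : ∀ a : LeftIdeal φ, e * (e * a.1) = e * a.1 := fun a => by rw [← mul_assoc, he.eq]
    let p : LeftIdeal φ → he.Corner := fun a => cornerMk he (e * a.1) (hp a)
      (by rw [mul_assoc]; exact congrArg (e * ·) a.2)
    have key : ∀ (h : carrier (pullObj φ (pushObj φ Y))) (a : LeftIdeal φ),
        h.1.1 a = act Y (h.1.1 ⟨e, he.eq⟩) (p a) := fun h a =>
      (congrArg (fun k => k.1 a) h.2).symm.trans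
        ((congrArg h.1.1 (Subtype.ext (hp a).symm)).trans (h.1.2 ⟨e, he.eq⟩ (p a)))
    refine ⟨pushObj φ Y, ⟨@asIso _ _ _ _ ((pullPushAdj φ).counit.app Y)
      (isIso_of_bijective _ ⟨fun h k hk => ?_, fun y => ?_⟩)⟩⟩
    · refine Subtype.ext (Subtype.ext (funext fun a => ?_))
      exact (key h a).trans ((congrArg (fun y => act Y y _) hk).trans (key k a).symm)
    · refine ⟨⟨⟨fun a => act Y y (p a), fun a m => ?_⟩, ?_⟩, ?_⟩
      · refine Eq.trans ?_ (act_mul Y y (p a) m)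
        exact congrArg (act Y y) (Subtype.ext (mul_assoc e a.1 m.1).symm)
      · exact Subtype.ext (funext fun a => congrArg (act Y y) (Subtype.ext (hp a)))
      · exact (congrArg (act Y y) (Subtype.ext he.eq)).trans (act_one Y y)⟩
  exact Functor.IsEquivalence.mk (F := pull (cornerIncl he))

/-! ### The fibre of an object of a slice -/

section

variable (φ : M →* N) (X : PSh N) (x : carrier X) (hx : ∀ m, act X x (φ m) = x)

/-- The fibre over a point `x` fixed by `φ M`, as an `M`-set. -/
def fibreObj (E : Over X) : PSh M :=
  mkPSh {y : carrier E.left // toFun E.hom y = x}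
    (fun y m => ⟨act E.left y.1 (φ m), by rw [toFun_act, y.2]; exact hx m⟩)
    (fun y => Subtype.ext (by
      change act E.left y.1 (φ 1) = y.1
      rw [map_one, act_one]))
    (fun y m n => Subtype.ext (by
      change act E.left y.1 (φ (m * n)) = act E.left (act E.left y.1 (φ m)) (φ n)
      rw [map_mul, act_mul]))

/-- The functor sending an object of the slice over `X` to its fibre over `x`. -/
def fibre : Over X ⥤ PSh M where
  obj := fibreObj φ X x hx
  map {E E'} f := mkHom (X := fibreObj φ X x hx E) (Y := fibreObj φ X x hx E')
    (fun y => ⟨toFun f.left y.1, (toFun_over_w f y.1).trans y.2⟩)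
    (fun y m => Subtype.ext (toFun_act f.left y.1 (φ m)))
  map_id _ := rfl
  map_comp _ _ := rfl

variable {φ X x}
-- Each `y` equals `(y u) v` with `y u` in the fibre, so values on the fibre determine a map.
lemma fibre_faithful (hcov : ∀ z : carrier X, ∃ u v, u * v = 1 ∧ act X z u = x) :
     (fibre φ X x hx).Faithful := ⟨fun {E E' f g} h => by
  ext1
  refine hom_ext fun y => ?_
  obtain ⟨u, v, huv, hu⟩ := hcov (toFun E.hom y)
  have h1 := congrArg (fun k : fibreObj φ X x hx E ⟶ fibreObj φ X x hx E' =>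
    (toFun k ⟨act E.left y u, (toFun_act _ _ _).trans hu⟩).1) h
  have h2 : toFun f.left (act E.left y u) = toFun g.left (act E.left y u) := h1
  rw [← act_one E.left y, ← huv, act_mul, toFun_act, h2, ← toFun_act]⟩

lemma fibre_full (hstab : ∀ n, act X x n = x → n ∈ Set.range φ)
    (hcov : ∀ z : carrier X, ∃ u v, u * v = 1 ∧ act X z u = x) :
     (fibre φ X x hx).Full := ⟨fun {E E'} h => by
  choose u v huv hu using fun y : carrier E.left => hcov (toFun E.hom y)
  have hmem : ∀ y, toFun E.hom (act E.left y (u y)) = x := fun y => (toFun_act _ _ _).trans (hu y)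
  let H : carrier (fibreObj φ X x hx E) → carrier E'.left := fun y => (toFun h y).1
  -- If `y` and `y c` both lie over `x`, then `c` stabilises `x`, hence `c = φ m` and equivariance
  -- over `M` applies.
  have key : ∀ (y z : carrier (fibreObj φ X x hx E)) (c : N), z.1 = act E.left y.1 c →
      H z = act E'.left (H y) c := by
    intro y z c hz
    obtain ⟨m, rfl⟩ := hstab c (by
      have := congrArg (toFun E.hom) hz
      rw [toFun_act, z.2, y.2] at this
      exact this.symm)
    have : z = act _ y m := Subtype.ext hz
    change (toFun h z).1 = _
    rw [this]
    exact congrArg Subtype.val (toFun_act h y m)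
  let F : carrier E.left → carrier E'.left := fun y => act E'.left (H ⟨_, hmem y⟩) (v y)
  -- `F` can be computed from any expression of `z` as a translate of a point of the fibre. So the
  -- arbitrary choices of `u` and `v` do not matter, and equivariance follows.
  have hF : ∀ (y : carrier (fibreObj φ X x hx E)) (z : carrier E.left) (c : N),
      z = act E.left y.1 c → F z = act E'.left (H y) c := by
    intro y z c hz
    change act E'.left (H ⟨_, hmem z⟩) (v z) = _
    rw [key y ⟨_, hmem z⟩ (c * u z) (by rw [act_mul, ← hz]), ← act_mul, mul_assoc, huv, mul_one]
  let f : E.left ⟶ E'.left := mkHom F fun y n => by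
    change _ = act E'.left (act E'.left (H ⟨_, hmem y⟩) (v y)) n
    rw [← act_mul]
    refine hF _ _ _ ?_
    change act E.left y n = act E.left (act E.left y (u y)) (v y * n)
    rw [← act_mul, ← mul_assoc, huv, one_mul]
  refine ⟨Over.homMk f (hom_ext fun y => ?_), hom_ext fun y => Subtype.ext ?_⟩
  · change toFun E'.hom (act E'.left (H ⟨_, hmem y⟩) (v y)) = toFun E.hom y
    rw [toFun_act]
    have h1 : toFun E'.hom (H ⟨_, hmem y⟩) = x := (toFun h _).2
    rw [h1]
    change act X x (v y) = _
    rw [← hu y, ← act_mul, huv, act_one]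
  · exact (hF y y.1 1 (act_one _ _).symm).trans (act_one _ _)⟩

/-- The right adjoint of the fibre functor, on objects: pairs of a point `z` and a partial
equivariant function defined on `{a | z a = x}`. -/
def cofibreObj (φ : M →* N) (X : PSh N) (x : carrier X) (Y : PSh M) : PSh N :=
  mkPSh {p : carrier X × (N → Option (carrier Y)) //
      (∀ a, (p.2 a).isSome ↔ act X p.1 a = x) ∧
      ∀ a m y, p.2 a = some y → p.2 (a * φ m) = some (act Y y m)}
    (fun p n => ⟨(act X p.1.1 n, fun a => p.1.2 (n * a)),
      fun a => by rw [← act_mul]; exact p.2.1 _,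
      fun a m y h => by
        change p.1.2 (n * (a * φ m)) = _
        rw [← mul_assoc]
        exact p.2.2 _ _ _ h⟩)
    (fun p => Subtype.ext (Prod.ext (act_one _ _) (funext fun a => congrArg p.1.2 (one_mul a))))
    (fun p m n => Subtype.ext (Prod.ext (act_mul _ _ _ _)
      (funext fun a => congrArg p.1.2 (mul_assoc m n a))))

/-- The projection of `cofibreObj` to the base. -/
def cofibre (φ : M →* N) (X : PSh N) (x : carrier X) (Y : PSh M) : Over X :=
  Over.mk (mkHom (X := cofibreObj φ X x Y) (Y := X) (fun p => p.1.1) fun _ _ => rfl)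

/-- Over `x` itself, the partial functions have domain exactly `φ(M)`, so equivariance makes
evaluation at `1` injective. Injectivity of `φ` makes `φ m ↦ y m` well defined for every `y`, giving
surjectivity. -/
lemma fibre_essSurj (hinj : Function.Injective φ)
    (hstab : ∀ n, act X x n = x → n ∈ Set.range φ) :
     (fibre φ X x hx).EssSurj := ⟨fun Y => by
  classical
  have hval : ∀ p : carrier (fibreObj φ X x hx (cofibre φ X x Y)), (p.1.1.2 1).isSome :=
    fun p => (p.1.2.1 1).2 ((act_one _ _).trans p.2)
  let ev : fibreObj φ X x hx (cofibre φ X x Y) ⟶ Y :=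
    mkHom (fun p => (p.1.1.2 1).get (hval p)) fun p m => by
      refine Option.get_of_eq_some _ ?_
      change p.1.1.2 (φ m * 1) = _
      rw [mul_one, ← one_mul (φ m)]
      exact p.1.2.2 1 m _ (Option.some_get _).symm
  refine ⟨cofibre φ X x Y, ⟨@asIso _ _ _ _ ev (isIso_of_bijective _ ⟨fun p q h => ?_, fun y => ?_⟩)⟩⟩
  · have hz : ∀ p : carrier (fibreObj φ X x hx (cofibre φ X x Y)), p.1.1.1 = x := fun p => p.2
    have hform : ∀ p m, p.1.1.2 (φ m) = some (act Y (toFun ev p) m) := fun p m => by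
      rw [← one_mul (φ m)]
      exact p.1.2.2 1 m _ (Option.some_get _).symm
    refine Subtype.ext (Subtype.ext (Prod.ext (p.2.trans q.2.symm) (funext fun a => ?_)))
    by_cases ha : act X x a = x
    · obtain ⟨m, rfl⟩ := hstab a ha
      exact (hform p m).trans ((congrArg (fun y => some (act Y y m)) h).trans (hform q m).symm)
    · have hnone : ∀ p : carrier (fibreObj φ X x hx (cofibre φ X x Y)), p.1.1.2 a = none :=
        fun p => by
          rw [← Option.not_isSome_iff_eq_none, p.1.2.1, hz]
          exact ha
      exact (hnone p).trans (hnone q).symm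
  · let H : N → Option (carrier Y) := fun a =>
      if h : a ∈ Set.range φ then some (act Y y h.choose) else none
    have hH : ∀ m, H (φ m) = some (act Y y m) := fun m => by
      have hm : φ m ∈ Set.range φ := ⟨m, rfl⟩
      change dite _ _ _ = _
      rw [dif_pos hm, hinj hm.choose_spec]
    have hHn : ∀ a, a ∉ Set.range φ → H a = none := fun a ha => dif_neg ha
    refine ⟨⟨⟨(x, H), fun a => ?_, fun a m z hz => ?_⟩, rfl⟩, ?_⟩
    · by_cases ha : a ∈ Set.range φ
      · obtain ⟨m, rfl⟩ := ha
        change (H (φ m)).isSome ↔ act X x (φ m) = x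
        simp [hH, hx]
      · change (H a).isSome ↔ act X x a = x
        rw [hHn a ha]
        exact ⟨fun h => by simp at h, fun h => (ha (hstab a h)).elim⟩
    · change H a = some z at hz
      change H (a * φ m) = _
      by_cases ha : a ∈ Set.range φ
      · obtain ⟨k, rfl⟩ := ha
        rw [hH, Option.some_inj] at hz
        rw [← map_mul, hH, act_mul, hz]
      · rw [hHn a ha] at hz
        simp at hz
    · refine Option.get_of_eq_some _ ?_
      change H 1 = _
      rw [← map_one φ, hH, act_one]⟩

end

/-! ### Étaleness from the algebraic conditions -/

section

variable (φ : M →* N) (X : PSh N) (x : carrier X) (hx : ∀ m, act X x (φ m) = x)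

/-- The second projection on the fibre over `x` of `X × Y → X`. -/
noncomputable def fibreStarSnd (Y : PSh N) (p : carrier (fibreObj φ X x hx ((Over.star X).obj Y))) :
    carrier Y :=
  toFun (prod.snd : X ⨯ Y ⟶ Y) p.1

/-- The fibre over `x` of `X × Y → X` maps to the restriction of `Y` along `φ`. -/
noncomputable def fibreStarHom : Over.star X ⋙ fibre φ X x hx ⟶ (ofMonoidHom φ).inverseImage where
  app Y := mkHom (X := fibreObj φ X x hx ((Over.star X).obj Y))
    (Y := (SingleObj.mapHom M N φ).op ⋙ Y)
    (fibreStarSnd φ X x hx Y) fun p m => toFun_act (prod.snd : X ⨯ Y ⟶ Y) p.1 (φ m)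
  naturality Y Y' f := hom_ext fun p => by
    have h : ((Over.star X).map f).left ≫ (prod.snd : X ⨯ Y' ⟶ Y') = prod.snd ≫ f :=
      (congrArg (· ≫ prod.snd) (Over.star_map_left X f)).trans (prod.map_snd _ _)
    exact congrArg (fun k : X ⨯ Y ⟶ Y' => toFun k p.1) h

/-- Elements are maps from the regular `N`-set, so the universal property of the product gives joint
injectivity of the projections. -/
lemma prod_ext {X Y : PSh N} {p q : carrier (X ⨯ Y)}
    (h1 : toFun (prod.fst : X ⨯ Y ⟶ X) p = toFun prod.fst q)
    (h2 : toFun (prod.snd : X ⨯ Y ⟶ Y) p = toFun prod.snd q) : p = q := by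
  have h : orbitMap (X ⨯ Y) p = orbitMap (X ⨯ Y) q := by
    ext1
    all_goals
      refine regular_hom_ext ?_
      rw [toFun_comp, toFun_comp, toFun_orbitMap_gen, toFun_orbitMap_gen]
      assumption
  rw [← toFun_orbitMap_gen _ p, h, toFun_orbitMap_gen]

/-- A point of `X ⨯ Y` over `x` is a pair `(x, y)`, freely determined by `y`. -/
lemma isIso_fibreStarHom : IsIso (fibreStarHom φ X x hx) := by
  have : ∀ Y, IsIso ((fibreStarHom φ X x hx).app Y) := fun Y => by
    have hfst : ((Over.star X).obj Y).hom = (prod.fst : X ⨯ Y ⟶ X) :=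
      (Over.star_obj_hom X Y).trans (prod.lift_fst _ _)
    refine isIso_of_bijective _ ⟨fun p q h => Subtype.ext (prod_ext ?_ h), fun y => ?_⟩
    · exact (congrArg (fun k : X ⨯ Y ⟶ X => toFun k p.1) hfst).symm.trans
        (p.2.trans (q.2.symm.trans (congrArg (fun k : X ⨯ Y ⟶ X => toFun k q.1) hfst)))
    · let k : regular N ⟶ X ⨯ Y := prod.lift (orbitMap X x) (orbitMap Y y)
      have h1 : k ≫ prod.fst = orbitMap X x := prod.lift_fst _ _
      have h2 : k ≫ prod.snd = orbitMap Y y := prod.lift_snd _ _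
      refine ⟨⟨toFun k (gen N), ?_⟩, ?_⟩
      · refine (congrArg (fun l : X ⨯ Y ⟶ X => toFun l (toFun k (gen N))) hfst).trans ?_
        exact (congrArg (fun l => toFun l (gen N)) h1).trans (toFun_orbitMap_gen _ _)
      · exact (congrArg (fun l => toFun l (gen N)) h2).trans (toFun_orbitMap_gen _ _)
  exact NatIso.isIso_of_isIso_app _

end

/-- The orbit of the subset `S` of `N` under the right action `A · n = {a | n a ∈ A}`. -/
def orbitOf (S : Set N) : PSh N :=
  mkPSh {A : Set N // ∃ n, A = {a | n * a ∈ S}}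
    (fun A n => ⟨{a | n * a ∈ A.1}, by
      obtain ⟨_, k, rfl⟩ := A
      exact ⟨k * n, Set.ext fun a => iff_of_eq (congrArg (· ∈ S) (mul_assoc k n a).symm)⟩⟩)
    (fun A => Subtype.ext (by simp))
    (fun A m n => Subtype.ext (by simp [mul_assoc]))

theorem isEtale_ofMonoidHom (φ : M →* N) (hinj : Function.Injective φ)
    (hfac : RightFactorable (Set.range φ))
    (hinv : ∀ n : N, ∃ u ∈ rightInvertible N, n * u ∈ Set.range φ) :
    (ofMonoidHom φ).IsEtale := by
  let X := orbitOf (Set.range φ)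
  let x : carrier X := ⟨Set.range φ, 1, Set.ext fun a =>
    iff_of_eq (congrArg (· ∈ Set.range φ) (one_mul a).symm)⟩
  -- Right-factorability gives `{a | φ m * a ∈ φ(M)} ⊆ φ(M)`; closure under products gives the
  -- reverse inclusion.
  have hfix : ∀ n ∈ Set.range φ, act X x n = x := by
    rintro _ ⟨m, rfl⟩
    refine Subtype.ext (Set.ext fun a => ⟨fun h => hfac _ a ⟨m, rfl⟩ h, ?_⟩)
    rintro ⟨k, rfl⟩
    exact ⟨m * k, map_mul φ m k⟩
  have hx : ∀ m, act X x (φ m) = x := fun m => hfix _ ⟨m, rfl⟩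
  have hstab : ∀ n, act X x n = x → n ∈ Set.range φ := fun n hn => by
    have h : {a | n * a ∈ Set.range φ} = Set.range φ := congrArg Subtype.val hn
    have h1 : (1 : N) ∈ {a | n * a ∈ Set.range φ} := by
      rw [h]
      exact ⟨1, map_one φ⟩
    simpa using h1
  have hcov : ∀ z : carrier X, ∃ u v, u * v = 1 ∧ act X z u = x := by
    rintro ⟨_, n, rfl⟩
    obtain ⟨u, ⟨v, huv⟩, hu⟩ := hinv n
    refine ⟨u, v, huv, Eq.trans (Subtype.ext ?_) (hfix _ hu)⟩
    exact Set.ext fun a => iff_of_eq (congrArg (· ∈ Set.range φ) (mul_assoc n u a).symm)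
  have := fibre_faithful hx hcov
  have := fibre_full hx hstab hcov
  have := fibre_essSurj hx hinj hstab
  have : (fibre φ X x hx).IsEquivalence := { }
  have := isIso_fibreStarHom φ X x hx
  exact ⟨X, (fibre φ X x hx).asEquivalence.symm, ⟨(asIso (fibreStarHom φ X x hx)).symm⟩⟩

/-- A semigroup homomorphism factors as a monoid homomorphism followed by the inclusion of a
corner, and so does the induced inverse image functor. -/
noncomputable def pullCornerIso (φ : M →ₙ* N) :
    (ofMulHom (cornerIncl (idem φ))).inverseImage ⋙ (ofMonoidHom (monoidPart φ)).inverseImage ≅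
      (ofMulHom φ).inverseImage :=
  NatIso.ofComponents (fun X =>
    { hom := mkHom (X := (SingleObj.mapHom _ _ (monoidPart φ)).op ⋙ pullObj (cornerIncl (idem φ)) X)
        (Y := pullObj φ X) (fun x => x) (fun _ _ => rfl)
      inv := mkHom (X := pullObj φ X)
        (Y := (SingleObj.mapHom _ _ (monoidPart φ)).op ⋙ pullObj (cornerIncl (idem φ)) X)
        (fun x => x) (fun _ _ => rfl)
      hom_inv_id := rfl
      inv_hom_id := rfl }) (fun _ => rfl)

theorem conditions_of_isEtale_ofMonoidHom (φ : M →* N) (h : (ofMonoidHom φ).IsEtale) :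
    Function.Injective φ ∧ RightFactorable (Set.range φ) ∧
      ∀ n : N, ∃ u ∈ rightInvertible N, n * u ∈ Set.range φ := by
  have h1 : ((φ : M →ₙ* N) 1 : N) = 1 := map_one φ
  obtain ⟨hinj, hfac, hinv⟩ := conditions_of_isEtale (φ : M →ₙ* N)
    (isEtale_of_iso (pullIso φ).symm h)
  simp only [h1, one_mul, mul_one] at hfac hinv
  refine ⟨hinj, fun a b ha hab => hfac a b ha hab trivial trivial, fun n => ?_⟩
  obtain ⟨u, v, huv, -, -, hn⟩ := hinv n trivial
  exact ⟨u, ⟨v, huv⟩, hn⟩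

lemma mem_range_monoidPart (φ : M →ₙ* N) (n : (idem φ).Corner) :
    n ∈ Set.range (monoidPart φ) ↔ n.1 ∈ Set.range φ :=
  exists_congr fun _ => Subtype.ext_iff

theorem conditions_of_isEtale_ofMulHom (φ : M →ₙ* N) (h : (ofMulHom φ).IsEtale) :
    (Function.Injective (monoidPart φ) ∧ RightFactorable (Set.range (monoidPart φ)) ∧
      ∀ n : (idem φ).Corner, ∃ u ∈ rightInvertible (idem φ).Corner,
        n * u ∈ Set.range (monoidPart φ)) ∧
      (ofMulHom (cornerIncl (idem φ))).IsEquivalence := by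
  obtain ⟨hinj, hfac, hinv⟩ := conditions_of_isEtale φ h
  have hc : ∀ n : (idem φ).Corner, φ 1 * n.1 = n.1 ∧ n.1 * φ 1 = n.1 :=
    fun n => (Subsemigroup.mem_corner_iff (idem φ)).1 n.2
  have he := map_one_mul φ 1
  refine ⟨⟨fun m m' hm => hinj (congrArg Subtype.val hm), fun a b ha hab => ?_, fun n => ?_⟩, ?_⟩
  · rw [mem_range_monoidPart] at ha hab ⊢
    exact hfac a.1 b.1 ha hab (hc b).1 (hc b).2
  · obtain ⟨u, v, huv, hu, hv, hn⟩ := hinv n.1 (hc n).1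
    -- Compressing to the corner: `(e u)(v e) = e`, and `n (e u) = n u` because `n e = n`.
    refine ⟨cornerMk (idem φ) (φ 1 * u) (by rw [← mul_assoc, he]) (by rw [mul_assoc, hu]),
      ⟨cornerMk (idem φ) (v * φ 1) (by rw [← mul_assoc, hv]) (by rw [mul_assoc, he]),
        Subtype.ext ?_⟩, (mem_range_monoidPart _ _).2 ?_⟩
    · change φ 1 * u * (v * φ 1) = φ 1
      rw [mul_assoc, ← mul_assoc u, huv, one_mul, he]
    · change n.1 * (φ 1 * u) ∈ _
      rwa [← mul_assoc, (hc n).2]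
  · obtain ⟨u, v, huv, hu, hv, -⟩ := hinv (φ 1) he
    exact isEquivalence_cornerIncl (idem φ) huv hu hv

end MonoidTopos

theorem mainTheorem1 {M N : Type u} [Monoid M] [Monoid N] :
    (∀ φ : M →* N,
      (MonoidTopos.ofMonoidHom φ).IsEtale ↔
        Function.Injective φ ∧
        MonoidTopos.RightFactorable (Set.range φ) ∧
        ∀ n : N, ∃ u ∈ MonoidTopos.rightInvertible N, n * u ∈ Set.range φ) ∧
    (∀ φ : M →ₙ* N,
      (MonoidTopos.ofMulHom φ).IsEtale ↔
        (Function.Injective (MonoidTopos.monoidPart φ) ∧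
          MonoidTopos.RightFactorable (Set.range (MonoidTopos.monoidPart φ)) ∧
          ∀ n : (MonoidTopos.idem φ).Corner,
            ∃ u ∈ MonoidTopos.rightInvertible (MonoidTopos.idem φ).Corner,
              n * u ∈ Set.range (MonoidTopos.monoidPart φ)) ∧
        (MonoidTopos.ofMulHom (MonoidTopos.cornerIncl (MonoidTopos.idem φ))).IsEquivalence) := by
  refine ⟨fun φ => ⟨MonoidTopos.conditions_of_isEtale_ofMonoidHom φ, fun ⟨hinj, hfac, hinv⟩ =>
    MonoidTopos.isEtale_ofMonoidHom φ hinj hfac hinv⟩, fun φ =>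
    ⟨MonoidTopos.conditions_of_isEtale_ofMulHom φ, fun ⟨⟨hinj, hfac, hinv⟩, heq⟩ => ?_⟩⟩
  exact MonoidTopos.isEtale_of_comp_isEquivalence
    (MonoidTopos.isEtale_ofMonoidHom _ hinj hfac hinv) heq (MonoidTopos.pullCornerIso φ)
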